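/- **Setting.** An observable on $\mathbb C^d$ with finite outcome set $\Omega$ is a map $\mathsf A:\Omega\to M_d(\mathbb C)$ with $\mathsf A(x)\ge 0$ and $\sum_x \mathsf A(x)=\mathbb 1$; a state is a positive operator of trace one. Observables $\mathsf A_i$ on $\Omega_i$, $i=1,\dots,m$, are *$k$-compatible* if there is an observable $\mathsf G$ on $(\mathbb C^d)^{\otimes k}$ with outcome set $\Omega_1\times\dots\times\Omega_m$ such that $\operatorname{tr}\big[\varrho^{\otimes k}\sum_{x:\,x_i=y}\mathsf G(x)\big]=\operatorname{tr}[\varrho\,\mathsf A_i(y)]$ for all $i$, all $y\in\Omega_i$ and all states $\varrho$. A *compatibility stack* on a set $V$ with $n$ elements is a list $(E_1,\dots,E_n)$ of sets of non-empty subsets of $V$ such that: (S1) every non-empty subset of a member of $E_k$ is in $E_k$; (S2) $E_1$ contains all singletons and $E_n$ consists of all non-empty subsets of $V$; (S3) if $\mathcal A\in E_k$, $\mathcal B\in E_l$ and $k+l\le n$, then $\mathcal A\cup\mathcal B\in E_{k+l}$. It is *realized* by pairwise distinct observables $(\mathsf A_v)_{v\in V}$ if, for each $k=1,\dots,n$,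 $E_k$ is exactly the set of those non-empty $S\subseteq V$ for which $(\mathsf A_v)_{v\in S}$ is $k$-compatible. For $0\le a,b,c\le 1$ the noisy qubit spin observables with outcomes $\pm1$ are $\mathsf X_a(\pm1)=\frac12(\mathbb 1\pm a\sigma_x)$, $\mathsf Y_b(\pm1)=\frac12(\mathbb 1\pm b\sigma_y)$, $\mathsf Z_c(\pm1)=\frac12(\mathbb 1\pm c\sigma_z)$. On the vertex set $\{0,1,2\}$ let $P$ be the set of all non-empty subsets and $\Sigma=\{\{0\},\{1\},\{2\}\}$. Consider the six stacks $(E_1,E_2,E_3)$, all with $E_3=P$: (a) $E_1=E_2=P$; (b) $E_1=P\setminus\{\{0,1,2\}\}$, $E_2=P$; (c) $E_1=\Sigma\cup\{\{0,2\},\{1,2\}\}$, $E_2=P$; (d) $E_1=\Sigma\cup\{\{0,2\}\}$, $E_2=P$; (e) $E_1=\Sigma$, $E_2=P$; (f) $E_1=\Sigma$, $E_2=P\setminus\{\{0,1,2\}\}$. **Theorem.** 1. Every compatibility stack on a three-element set is, up to a relabelling of the vertices, exactly one of (a)–(f). 2. Every compatibility stack on a three-element set $V$ has a realization by noisy qubit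 spin observables: for every labelling of the vertices by $0,1,2$ there are $a,b,c\in[0,1]$ such that assigning $\mathsf X_a,\mathsf Y_b,\mathsf Z_c$ to the vertices labelled $0,1,2$, respectively, realizes the stack. 3. Explicitly, with $\mathsf X_a,\mathsf Y_b,\mathsf Z_c$ assigned to $0,1,2$: (a) is realized by $a=b=c=1/\sqrt3$; (b) by $a=b=c=1/\sqrt2$; (c) by $a=b=4/5$, $c=3/5$; (d) by $a=4/5$, $b=1$, $c=3/5$; (e) by $a=b=c=(1+\sqrt2)/3$; and (f) by $a=b=c$ for every value in $(\sqrt3/2,1]$, in particular by $a=b=c=1$. -/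

import Mathlib

namespace QStack

/-! ### Observables and states on the Hilbert space `ℂ^d` (`d` a finite index type) -/

section Quantum

open scoped ComplexOrder

variable {d Ω : Type*} [Fintype d] [DecidableEq d]

/-- A map `A : Ω → L(ℂ^d)` on a finite outcome set is an observable if its values are positive
operators that sum up to the identity. -/
def IsObservable [Fintype Ω] (A : Ω → Matrix d d ℂ) : Prop :=
  (∀ x, (A x).PosSemidef) ∧ ∑ x, A x = 1

/-- States: positive operators of trace one. -/
def IsState (ρ : Matrix d d ℂ) : Prop :=
  ρ.PosSemidef ∧ ρ.trace = 1

/-- The tensor power `A^{⊗k}` on `(ℂ^d)^{⊗k}`, in the product basis, which is indexed by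
`Fin k → d`. -/
def tensorPow (k : ℕ) (A : Matrix d d ℂ) : Matrix (Fin k → d) (Fin k → d) ℂ :=
  Matrix.of fun i j => ∏ m, A (i m) (j m)

/-- The `i`-th marginal `G^{[i]}(y) = ∑_{x, x_i = y} G(x)` of a map on a product of outcome
sets. -/
def marginal {ι D : Type*} [Fintype ι] [DecidableEq ι] {Ω : ι → Type*}
    [∀ i, Fintype (Ω i)] [∀ i, DecidableEq (Ω i)]
    (G : (∀ i, Ω i) → Matrix D D ℂ) (i : ι) (y : Ω i) : Matrix D D ℂ :=
  ∑ x : ∀ i, Ω i with x i = y, G x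

/-- A finite family of observables on `ℂ^d` is `k`-compatible if there is an observable `G` on
`(ℂ^d)^{⊗k}` whose outcome set is the product of the outcome sets, and such that
`tr (ρ^{⊗k} G^{[i]}(x)) = tr (ρ A_i(x))` for all `i`, all outcomes `x` and all states `ρ`. -/
def KCompatible {ι : Type*} [Fintype ι] [DecidableEq ι] {Ω : ι → Type*}
    [∀ i, Fintype (Ω i)] [∀ i, DecidableEq (Ω i)]
    (k : ℕ) (A : ∀ i, Ω i → Matrix d d ℂ) : Prop :=
  ∃ G : (∀ i, Ω i) → Matrix (Fin k → d) (Fin k → d) ℂ,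
    IsObservable G ∧
      ∀ i, ∀ x : Ω i, ∀ ρ : Matrix d d ℂ, IsState ρ →
        (tensorPow k ρ * marginal G i x).trace = (ρ * A i x).trace

end Quantum

/-! ### Abstract compatibility stacks -/

/-- A compatibility stack `(H_1, …, H_n)` on a set `V` with `n` elements. The hypergraph
`H_k = (V, E_k)` is given by its set of edges; `E_k` is `E ⟨k - 1, _⟩` for `k = 1, …, n`. -/
structure CompatibilityStack (V : Type*) [Fintype V] [DecidableEq V] (n : ℕ) where
  /-- The sets of edges. -/
  E : Fin n → Finset (Finset V)
  card_eq : Fintype.card V = n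
  /-- Edges are non-empty. -/
  nonempty_of_mem : ∀ k, ∀ S ∈ E k, S.Nonempty
  /-- (S1) Non-empty subsets of edges are edges. -/
  mem_of_subset : ∀ k, ∀ S ∈ E k, ∀ T ⊆ S, T.Nonempty → T ∈ E k
  /-- (S2) The first hypergraph contains all the singletons. -/
  singleton_mem : ∀ k : Fin n, (k : ℕ) + 1 = 1 → ∀ v, {v} ∈ E k
  /-- (S2) The last hypergraph contains all the non-empty subsets. -/
  mem_last : ∀ k : Fin n, (k : ℕ) + 1 = n → ∀ S : Finset V, S.Nonempty → S ∈ E k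
  /-- (S3) If `S ∈ E_k` and `T ∈ E_l`, then `S ∪ T ∈ E_{k+l}`. -/
  union_mem : ∀ k l m : Fin n, (m : ℕ) + 1 = ((k : ℕ) + 1) + ((l : ℕ) + 1) →
    ∀ S ∈ E k, ∀ T ∈ E l, S ∪ T ∈ E m

/-- Two stacks agree up to a relabelling of the vertices. -/
def CompatibilityStack.Iso {V W : Type*} [Fintype V] [DecidableEq V] [Fintype W] [DecidableEq W]
    {n : ℕ} (H : CompatibilityStack V n) (K : CompatibilityStack W n) : Prop :=
  ∃ e : V ≃ W, ∀ k, ∀ S : Finset V, S ∈ H.E k ↔ S.map e.toEmbedding ∈ K.E k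

/-- A stack is realized by a family of observables, indexed by the vertices, if these are pairwise
distinct and, for `k = 1, …, n`, the edges of `H_k` are exactly the non-empty sets of vertices
whose observables are `k`-compatible. -/
def CompatibilityStack.RealizedBy {V : Type*} [Fintype V] [DecidableEq V] {n : ℕ}
    (H : CompatibilityStack V n) {d Ω : Type*} [Fintype d] [DecidableEq d] [Fintype Ω]
    [DecidableEq Ω] (A : V → Ω → Matrix d d ℂ) : Prop :=
  (∀ v, IsObservable (A v)) ∧ Function.Injective A ∧
    ∀ k : Fin n, ∀ S : Finset V,
      S ∈ H.E k ↔ S.Nonempty ∧ KCompatible ((k : ℕ) + 1) (fun v : S => A v)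

/-! ### The six stacks with three vertices -/

/-- All non-empty subsets of the vertex set `{0, 1, 2}`. -/
def allSubsets : Finset (Finset (Fin 3)) :=
  {{0}, {1}, {2}, {0, 1}, {0, 2}, {1, 2}, {0, 1, 2}}

def stackA : CompatibilityStack (Fin 3) 3 where
  E := ![allSubsets, allSubsets, allSubsets]
  card_eq := by decide
  nonempty_of_mem := by decide +kernel
  mem_of_subset := by decide +kernel
  singleton_mem := by decide +kernel
  mem_last := by decide +kernel
  union_mem := by decide +kernel

def stackB : CompatibilityStack (Fin 3) 3 where
  E := ![{{0}, {1}, {2}, {0, 1}, {0, 2}, {1, 2}}, allSubsets, allSubsets]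
  card_eq := by decide
  nonempty_of_mem := by decide +kernel
  mem_of_subset := by decide +kernel
  singleton_mem := by decide +kernel
  mem_last := by decide +kernel
  union_mem := by decide +kernel

def stackC : CompatibilityStack (Fin 3) 3 where
  E := ![{{0}, {1}, {2}, {0, 2}, {1, 2}}, allSubsets, allSubsets]
  card_eq := by decide
  nonempty_of_mem := by decide +kernel
  mem_of_subset := by decide +kernel
  singleton_mem := by decide +kernel
  mem_last := by decide +kernel
  union_mem := by decide +kernel

def stackD : CompatibilityStack (Fin 3) 3 where
  E := ![{{0}, {1}, {2}, {0, 2}}, allSubsets, allSubsets]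
  card_eq := by decide
  nonempty_of_mem := by decide +kernel
  mem_of_subset := by decide +kernel
  singleton_mem := by decide +kernel
  mem_last := by decide +kernel
  union_mem := by decide +kernel

def stackE : CompatibilityStack (Fin 3) 3 where
  E := ![{{0}, {1}, {2}}, allSubsets, allSubsets]
  card_eq := by decide
  nonempty_of_mem := by decide +kernel
  mem_of_subset := by decide +kernel
  singleton_mem := by decide +kernel
  mem_last := by decide +kernel
  union_mem := by decide +kernel

def stackF : CompatibilityStack (Fin 3) 3 where
  E := ![{{0}, {1}, {2}}, {{0}, {1}, {2}, {0, 1}, {0, 2}, {1, 2}}, allSubsets]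
  card_eq := by decide
  nonempty_of_mem := by decide +kernel
  mem_of_subset := by decide +kernel
  singleton_mem := by decide +kernel
  mem_last := by decide +kernel
  union_mem := by decide +kernel

/-- The six stacks. -/
def sixStacks : Fin 6 → CompatibilityStack (Fin 3) 3 :=
  ![stackA, stackB, stackC, stackD, stackE, stackF]

/-! ### Noisy qubit spin observables -/

noncomputable section

def pauliX : Matrix (Fin 2) (Fin 2) ℂ := !![0, 1; 1, 0]

def pauliY : Matrix (Fin 2) (Fin 2) ℂ := !![0, -Complex.I; Complex.I, 0]

def pauliZ : Matrix (Fin 2) (Fin 2) ℂ := !![1, 0; 0, -1]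

/-- The map `±1 ↦ (1/2) (1 ± t σ)`; the outcome set `{+1, -1}` is the type `ℤˣ`. -/
def noisySpin (σ : Matrix (Fin 2) (Fin 2) ℂ) (t : ℝ) (s : ℤˣ) : Matrix (Fin 2) (Fin 2) ℂ :=
  (1 / 2 : ℂ) • (1 + (((s : ℤ) : ℂ) * (t : ℂ)) • σ)

/-- The triple `X_a, Y_b, Z_c`. -/
def spinTriple (a b c : ℝ) : Fin 3 → ℤˣ → Matrix (Fin 2) (Fin 2) ℂ :=
  ![noisySpin pauliX a, noisySpin pauliY b, noisySpin pauliZ c]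

end

end QStack

namespace QStack

open scoped ComplexOrder Kronecker MatrixOrder
open Matrix

/-! ### k-compatibility in any dimension: coarse-graining, products of copies, mixtures, duality. -/

section Generalities

/-! The classification is a count. Unions of singletons put every pair in E_2, so only the pairs and
the triple in E_1 and the triple in E_2 are free. The triple in E_1 forces the pairs in E_1, and any
pair in E_1 forces the triple in E_2. Ten labelled stacks remain, forming six classes under
relabelling, separated by the sizes of E_1 and E_2.

For spin observables with noise parameters r_i, a set S is 1-compatible iff the sum of r_i^2 over S
is at most 1 (`kCompatible_one_iff`). All pairs are 2-compatible and the triple is 3-compatible, by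
measuring each observable on its own copy (`KCompatible.union`). So a realization only has to get
these sums right and decide whether the triple is 2-compatible.

The triple is 2-compatible when some pair is 1-compatible, with the second copy serving the third
observable. Stack (e) has no such pair, and there a uniform mixture of three such schemes works
(`KCompatible.mix`). Incompatibility always comes from weak duality (`KCompatible.score_le`): a dual
operator √N·1 gives the one-copy bound, and √3 times the symmetric projection gives r_0 + r_1 + r_2
≤ 3√3/2 on two copies, which settles (f). -/

theorem trace_mul_nonneg_of_posSemidef {n : Type*} [Fintype n] {A B : Matrix n n ℂ}
    (hA : A.PosSemidef) (hB : B.PosSemidef) : 0 ≤ (A * B).trace := by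
  classical
  obtain ⟨C, rfl⟩ := CStarAlgebra.nonneg_iff_eq_star_mul_self.mp hA.nonneg
  rw [Matrix.mul_assoc, Matrix.trace_mul_comm, star_eq_conjTranspose]
  exact (hB.mul_mul_conjTranspose_same C).trace_nonneg

theorem trace_submatrix_equiv {m n R : Type*} [Fintype m] [Fintype n] [AddCommMonoid R]
    (A : Matrix n n R) (e : m ≃ n) : (A.submatrix e e).trace = A.trace :=
  e.sum_comp fun i => A i i

theorem tensorPow_add {d : Type*} (k l : ℕ) (A : Matrix d d ℂ) :
    tensorPow (k + l) A =
      (tensorPow k A ⊗ₖ tensorPow l A).submatrix (Fin.appendEquiv k l).symm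
        (Fin.appendEquiv k l).symm := by
  ext i j
  simp [tensorPow, Fin.prod_univ_add, Fin.appendEquiv]

theorem trace_tensorPow {d : Type*} [Fintype d] (k : ℕ) (A : Matrix d d ℂ) : (tensorPow k A).trace = A.trace ^ k := by
  simp only [Matrix.trace, tensorPow, Matrix.diag_apply, Matrix.of_apply]
  rw [Fintype.sum_pow]

theorem trace_tensor_mul {d : Type*} [Fintype d] {k l : ℕ} (ρ : Matrix d d ℂ) (B : Matrix (Fin k → d) (Fin k → d) ℂ)
    (C : Matrix (Fin l → d) (Fin l → d) ℂ) :
    (tensorPow (k + l) ρ * (B ⊗ₖ C).submatrix (Fin.appendEquiv k l).symm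
        (Fin.appendEquiv k l).symm).trace =
      (tensorPow k ρ * B).trace * (tensorPow l ρ * C).trace := by
  rw [tensorPow_add, Matrix.submatrix_mul_equiv, trace_submatrix_equiv,
    ← Matrix.mul_kronecker_mul, Matrix.trace_kronecker]

variable {d : Type*} [Fintype d] [DecidableEq d]

variable {ι Ω : Type*} [Fintype ι] [DecidableEq ι] [Fintype Ω] [DecidableEq Ω]

/-- Any finite outcome set will do for the joint observable: lump together the outcomes `l` that
yield the same vector of readings `f i l`. -/
theorem kCompatible_of_postprocessing {Λ : Type*} [Fintype Λ] {k : ℕ} {A : ι → Ω → Matrix d d ℂ}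
    {G : Λ → Matrix (Fin k → d) (Fin k → d) ℂ} (hG : IsObservable G) (f : ι → Λ → Ω)
    (h : ∀ i y ρ, IsState ρ →
      (tensorPow k ρ * ∑ l with f i l = y, G l).trace = (ρ * A i y).trace) :
    KCompatible k A := by
  classical
  refine ⟨fun x => ∑ l with (fun i => f i l) = x, G l, ⟨fun x => ?_, ?_⟩, fun i y ρ hρ => ?_⟩
  · exact Matrix.posSemidef_sum _ fun l _ => hG.1 l
  · rw [Finset.sum_fiberwise, hG.2]
  · rw [← h i y ρ hρ]
    congr 2
    rw [marginal, Finset.sum_fiberwise_eq_sum_filter]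
    simp

theorem KCompatible.comp {k : ℕ} {A : ι → Ω → Matrix d d ℂ}
    (h : KCompatible k A) {κ : Type*} [Fintype κ] [DecidableEq κ] (f : κ → ι) :
    KCompatible k (fun j => A (f j)) := by
  obtain ⟨G, hG, h⟩ := h
  exact kCompatible_of_postprocessing hG (fun j x => x (f j)) fun j y ρ hρ => h (f j) y ρ hρ

theorem KCompatible.mono {V : Type*} {k : ℕ} {A : V → Ω → Matrix d d ℂ} {S T : Finset V}
    [DecidableEq V]
    (h : KCompatible k (fun v : S => A v)) (hT : T ⊆ S) : KCompatible k (fun v : T => A v) :=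
  h.comp fun v : T => (⟨v, hT v.2⟩ : S)

theorem IsObservable.tensor {Λ M : Type*} [Fintype Λ] [Fintype M] {k l : ℕ}
    {G : Λ → Matrix (Fin k → d) (Fin k → d) ℂ} {G' : M → Matrix (Fin l → d) (Fin l → d) ℂ}
    (hG : IsObservable G) (hG' : IsObservable G') :
    IsObservable fun p : Λ × M => (G p.1 ⊗ₖ G' p.2).submatrix (Fin.appendEquiv k l).symm
        (Fin.appendEquiv k l).symm := by
  refine ⟨fun p => ((hG.1 _).kronecker (hG'.1 _)).submatrix _, ?_⟩
  have : ∑ p : Λ × M, G p.1 ⊗ₖ G' p.2 = 1 := by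
    rw [← Matrix.one_kronecker_one, ← hG.2, ← hG'.2, Fintype.sum_prod_type]
    ext i j
    simp [Matrix.sum_apply, Finset.sum_mul_sum]
  rw [← Matrix.submatrix_one_equiv (Fin.appendEquiv k l).symm, ← this]
  ext i j
  simp [Matrix.sum_apply]

/-- Measure the first observable on k copies and the second on the other l, and read `v` off the
first whenever `v ∈ S`. The factor that is not read contributes a power of tr ρ, which is 1. -/
theorem KCompatible.union {V : Type*} [DecidableEq V] {k l : ℕ} {A : V → Ω → Matrix d d ℂ}
    {S T : Finset V} (hS : KCompatible k (fun v : S => A v))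
    (hT : KCompatible l (fun v : T => A v)) :
    KCompatible (k + l) (fun v : (S ∪ T : Finset V) => A v) := by
  classical
  obtain ⟨G, hG, h⟩ := hS
  obtain ⟨G', hG', h'⟩ := hT
  refine kCompatible_of_postprocessing (hG.tensor hG')
    (fun v p => if hv : (v : V) ∈ S then p.1 ⟨v, hv⟩ else
      p.2 ⟨v, (Finset.mem_union.mp v.2).resolve_left hv⟩) fun v y ρ hρ => ?_
  have key : ∀ (P : (S → Ω) → Prop) (Q : (T → Ω) → Prop) [DecidablePred P] [DecidablePred Q],
      (tensorPow (k + l) ρ * ∑ p : (S → Ω) × (T → Ω) with P p.1 ∧ Q p.2,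
        (G p.1 ⊗ₖ G' p.2).submatrix (Fin.appendEquiv k l).symm (Fin.appendEquiv k l).symm).trace
      = (tensorPow k ρ * ∑ x with P x, G x).trace * (tensorPow l ρ * ∑ x with Q x, G' x).trace := by
    intro P Q _ _
    rw [Matrix.mul_sum, Matrix.trace_sum, Matrix.mul_sum, Matrix.mul_sum, Matrix.trace_sum,
      Matrix.trace_sum, Finset.sum_mul_sum, ← Finset.sum_product', ← Finset.univ_product_univ,
      Finset.filter_product]
    exact Finset.sum_congr rfl fun p _ => trace_tensor_mul _ _ _
  by_cases hv : (v : V) ∈ S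
  · simp only [hv, dite_true]
    have := key (fun x => x ⟨v, hv⟩ = y) (fun _ => True)
    simp only [and_true] at this
    rw [this]
    simp only [Finset.filter_true, hG'.2, trace_tensorPow, hρ.2, one_pow, mul_one]
    exact h ⟨v, hv⟩ y ρ hρ
  · have hv' := (Finset.mem_union.mp v.2).resolve_left hv
    simp only [hv, dite_false]
    have := key (fun _ => True) (fun x => x ⟨v, hv'⟩ = y)
    simp only [true_and] at this
    rw [this]
    simp only [Finset.filter_true, hG.2, Matrix.mul_one, trace_tensorPow, hρ.2, one_pow, one_mul]
    exact h' ⟨v, hv'⟩ y ρ hρ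

/-- Choose `j` at random with probability `p j` and use its joint observable; all conditions are
affine in `G`. -/
theorem KCompatible.mix {J : Type*} [Fintype J] {k : ℕ} {A : J → ι → Ω → Matrix d d ℂ}
    (h : ∀ j, KCompatible k (A j)) {p : J → ℝ} (hp : ∀ j, 0 ≤ p j) (hp1 : ∑ j, p j = 1) :
    KCompatible k (fun i y => ∑ j, (p j : ℂ) • A j i y) := by
  choose G hG h using h
  refine ⟨fun x => ∑ j, (p j : ℂ) • G j x, ⟨fun x => ?_, ?_⟩, fun i y ρ hρ => ?_⟩
  · exact Matrix.posSemidef_sum _ fun j _ => ((hG j).1 x).smul (by exact_mod_cast hp j)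
  · rw [Finset.sum_comm]
    simp_rw [← Finset.smul_sum, (hG _).2, ← Finset.sum_smul]
    rw [← Complex.ofReal_sum, hp1, Complex.ofReal_one, one_smul]
  · have : marginal (fun x => ∑ j, (p j : ℂ) • G j x) i y = ∑ j, (p j : ℂ) • marginal (G j) i y := by
      simp only [marginal]
      rw [Finset.sum_comm]
      simp_rw [Finset.smul_sum]
    rw [this]
    simp only [Matrix.mul_sum, Matrix.trace_sum, Matrix.mul_smul, Matrix.trace_smul, h _ i y ρ hρ]

/-- Weak duality: an operator that dominates all the combinations of tensor powers of test states
bounds the corresponding score of a `k`-compatible family. -/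
theorem KCompatible.score_le {J : Type*} [Fintype J] {k : ℕ} {A : ι → Ω → Matrix d d ℂ}
    (h : KCompatible k A) {ρ : ι → J → Matrix d d ℂ} (hρ : ∀ i j, IsState (ρ i j))
    (c : ι → J → Ω → ℂ) (K : Matrix (Fin k → d) (Fin k → d) ℂ)
    (hK : ∀ x : ι → Ω, (K - ∑ i, ∑ j, c i j (x i) • tensorPow k (ρ i j)).PosSemidef) :
    ∑ i, ∑ j, ∑ y, c i j y * (ρ i j * A i y).trace ≤ K.trace := by
  obtain ⟨G, hG, h⟩ := h
  have h0 : 0 ≤ ∑ x, ((K - ∑ i, ∑ j, c i j (x i) • tensorPow k (ρ i j)) * G x).trace :=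
    Finset.sum_nonneg fun x _ => trace_mul_nonneg_of_posSemidef (hK x) (hG.1 x)
  have h1 : ∑ x, (K * G x).trace = K.trace := by
    rw [← Matrix.trace_sum, ← Matrix.mul_sum, hG.2, Matrix.mul_one]
  have h2 : ∑ i, ∑ j, ∑ y, c i j y * (ρ i j * A i y).trace =
      ∑ x, ((∑ i, ∑ j, c i j (x i) • tensorPow k (ρ i j)) * G x).trace := by
    simp only [Matrix.sum_mul, Matrix.trace_sum, Matrix.smul_mul, Matrix.trace_smul]
    refine Eq.trans (Finset.sum_congr rfl fun i _ => ?_) Finset.sum_comm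
    refine Eq.trans (Finset.sum_congr rfl fun j _ => ?_) Finset.sum_comm
    refine Eq.trans ?_ (Finset.sum_fiberwise Finset.univ (fun x : ι → Ω => x i) _)
    refine Finset.sum_congr rfl fun y _ => ?_
    rw [← h i y _ (hρ i j), marginal, Matrix.mul_sum, Matrix.trace_sum, Finset.mul_sum]
    refine Finset.sum_congr rfl fun x hx => ?_
    rw [(Finset.mem_filter.mp hx).2, smul_eq_mul]
  simp only [Matrix.sub_mul, Matrix.trace_sub, Finset.sum_sub_distrib] at h0
  rw [h1, ← h2] at h0
  exact sub_nonneg.mp h0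

end Generalities

/-! ### Bloch form of qubit operators and the one-copy joint measurement. -/

noncomputable section Qubit

/-- The three Pauli matrices. -/
def pauli : Fin 3 → Matrix (Fin 2) (Fin 2) ℂ := ![pauliX, pauliY, pauliZ]

theorem spinTriple_apply (a b c : ℝ) (i : Fin 3) :
    spinTriple a b c i = noisySpin (pauli i) (![a, b, c] i) := by
  fin_cases i <;> rfl

/-- The operator `t 1 + v · σ`. -/
def bloch (t : ℝ) (v : Fin 3 → ℝ) : Matrix (Fin 2) (Fin 2) ℂ :=
  (t : ℂ) • 1 + ∑ i, (v i : ℂ) • pauli i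

theorem bloch_eq (t : ℝ) (v : Fin 3 → ℝ) :
    bloch t v = !![(t + v 2 : ℂ), v 0 - v 1 * Complex.I; v 0 + v 1 * Complex.I, t - v 2] := by
  ext i j
  fin_cases i <;> fin_cases j <;>
    simp [bloch, pauli, Fin.sum_univ_three, pauliX, pauliY, pauliZ] <;> ring

theorem isHermitian_bloch (t : ℝ) (v : Fin 3 → ℝ) : (bloch t v).IsHermitian := by
  rw [bloch_eq]
  ext i j
  fin_cases i <;> fin_cases j <;> simp [sub_eq_add_neg]

theorem bloch_mul_self (t : ℝ) (v : Fin 3 → ℝ) :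
    bloch t v * bloch t v = ((2 * t : ℝ) : ℂ) • bloch t v - ((t ^ 2 - ∑ i, v i ^ 2 : ℝ) : ℂ) • 1 := by
  simp only [bloch_eq]
  ext i j
  fin_cases i <;> fin_cases j <;>
    simp [Fin.sum_univ_three, Matrix.mul_apply] <;> ring_nf <;> simp

/-- By Cayley–Hamilton, 2t·B = B² + (t² − |v|²)·1 for the self-adjoint B = `bloch t v`, a sum of two
positive operators. Division by 2t is why `t` must be positive. -/
theorem posSemidef_bloch {t : ℝ} (ht : 0 < t) {v : Fin 3 → ℝ} (hv : ∑ i, v i ^ 2 ≤ t ^ 2) :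
    (bloch t v).PosSemidef := by
  have h1 : ((bloch t v) * (bloch t v)).PosSemidef := by
    have := posSemidef_conjTranspose_mul_self (bloch t v)
    rwa [(isHermitian_bloch t v).eq] at this
  have h2 : (((t ^ 2 - ∑ i, v i ^ 2 : ℝ) : ℂ) • (1 : Matrix (Fin 2) (Fin 2) ℂ)).PosSemidef :=
    PosSemidef.one.smul (by exact_mod_cast sub_nonneg.mpr hv)
  have h3 := (h1.add h2).smul (a := (((2 * t)⁻¹ : ℝ) : ℂ))
    (by exact_mod_cast (by positivity : (0 : ℝ) ≤ (2 * t)⁻¹))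
  rw [bloch_mul_self, sub_add_cancel, smul_smul, ← Complex.ofReal_mul,
    inv_mul_cancel₀ (by positivity), Complex.ofReal_one, one_smul] at h3
  exact h3

theorem noisySpin_pauli (i : Fin 3) (t : ℝ) (s : ℤˣ) :
    noisySpin (pauli i) t s = (1 / 2 : ℂ) • bloch 1 (Pi.single i (((s : ℤ) : ℝ) * t)) := by
  rw [noisySpin, bloch]
  congr 2
  · simp
  · rw [Finset.sum_eq_single i]
    · simp
    · intro j _ hj
      simp [hj]
    · simp

theorem units_cast_sq (s : ℤˣ) : (((s : ℤ) : ℝ)) ^ 2 = 1 := by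
  rcases Int.units_eq_one_or s with rfl | rfl <;> simp

theorem isObservable_noisySpin (i : Fin 3) {t : ℝ} (ht : t ^ 2 ≤ 1) :
    IsObservable (noisySpin (pauli i) t) := by
  refine ⟨fun s => ?_, ?_⟩
  · rw [noisySpin_pauli]
    refine (posSemidef_bloch one_pos ?_).smul (by norm_num [Complex.le_def])
    rw [Finset.sum_eq_single i] <;> simp +contextual [mul_pow, units_cast_sq, ht]
  · rw [UnitsInt.univ, Finset.sum_pair (by decide)]
    ext j k
    simp [noisySpin]
    ring

theorem trace_pauli (i : Fin 3) : (pauli i).trace = 0 := by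
  fin_cases i <;> simp [pauli, pauliX, pauliY, pauliZ, Matrix.trace, Fin.sum_univ_two]

theorem trace_pauli_mul_self (i : Fin 3) : (pauli i * pauli i).trace = 2 := by
  fin_cases i <;> simp [pauli, pauliX, pauliY, pauliZ, Matrix.trace, Fin.sum_univ_two] <;> norm_num

/-- The pure eigenstates of the Pauli matrices. -/
theorem isState_noisySpin_one (i : Fin 3) (s : ℤˣ) : IsState (noisySpin (pauli i) 1 s) := by
  refine ⟨(isObservable_noisySpin i (by norm_num)).1 s, ?_⟩
  simp [noisySpin, trace_pauli]

theorem trace_noisySpin_mul (i : Fin 3) (r t : ℝ) (s y : ℤˣ) :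
    (noisySpin (pauli i) r s * noisySpin (pauli i) t y).trace =
      (1 + ((s : ℤ) : ℂ) * r * ((y : ℤ) * t)) / 2 := by
  simp only [noisySpin, Matrix.smul_mul, Matrix.mul_smul, Matrix.add_mul, Matrix.mul_add,
    Matrix.trace_smul, Matrix.trace_add, trace_pauli, trace_pauli_mul_self, Matrix.one_mul,
    Matrix.mul_one, Matrix.trace_one, smul_eq_mul]
  simp
  ring

theorem tensorPow_one_eq (A : Matrix (Fin 2) (Fin 2) ℂ) :
    tensorPow 1 A = A.submatrix (fun f => f 0) (fun f => f 0) := by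
  ext i j
  simp [tensorPow]

/-! ### Joint measurements -/

theorem sum_pi_three {α M : Type*} [Fintype α] [AddCommMonoid M] (F : (Fin 3 → α) → M) :
    ∑ x, F x = ∑ a, ∑ b, ∑ c, F ![a, b, c] := by
  let e : (Fin 3 → α) ≃ α × α × α :=
    ⟨fun x => (x 0, x 1, x 2), fun p => ![p.1, p.2.1, p.2.2],
      fun x => by ext i; fin_cases i <;> rfl, fun p => by simp⟩
  rw [← e.symm.sum_comp F]
  simp only [Fintype.sum_prod_type]
  rfl

/-- The joint observable is (1/8)(1 + ∑ x_i r_i σ_i), positive because its Bloch vector has length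
at most 1; summing over the two other signs removes their terms. -/
theorem kCompatible_one_noisySpin {r : Fin 3 → ℝ} (hr : ∑ i, r i ^ 2 ≤ 1) :
    KCompatible 1 (fun i : Fin 3 => noisySpin (pauli i) (r i)) := by
  let e : (Fin 1 → Fin 2) ≃ Fin 2 := Equiv.funUnique _ _
  let g : (Fin 3 → ℤˣ) → Matrix (Fin 2) (Fin 2) ℂ :=
    fun x => (1 / 8 : ℂ) • bloch 1 (fun i => ((x i : ℤ) : ℝ) * r i)
  have hm : ∀ i y, marginal g i y = noisySpin (pauli i) (r i) y := by
    intro i y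
    simp only [marginal, Finset.sum_filter, g, noisySpin_pauli, bloch_eq]
    rw [sum_pi_three]
    rcases Int.units_eq_one_or y with rfl | rfl <;> fin_cases i <;>
    · simp [UnitsInt.univ]
      refine ⟨⟨?_, ?_⟩, ?_, ?_⟩ <;> ring
  -- The total is the sum over y of any one marginal, so normalization follows from that of the
  -- observable at vertex 0.
  have hs : ∑ x, g x = 1 := by
    rw [← Finset.sum_fiberwise Finset.univ (fun x : Fin 3 → ℤˣ => x 0) g]
    exact (Finset.sum_congr rfl fun y _ => hm 0 y).trans
      (isObservable_noisySpin 0 (t := r 0)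
        ((Finset.single_le_sum (f := fun i => r i ^ 2) (fun i _ => sq_nonneg _)
          (Finset.mem_univ 0)).trans hr)).2
  refine ⟨fun x => (g x).submatrix e e, ⟨fun x => ?_, ?_⟩, fun i y ρ hρ => ?_⟩
  · refine ((posSemidef_bloch one_pos ?_).smul (by norm_num [Complex.le_def])).submatrix _
    simpa [mul_pow, units_cast_sq] using hr
  · rw [← Matrix.submatrix_one_equiv e, ← hs]
    ext i j
    simp [Matrix.sum_apply]
  · have : marginal (fun x => (g x).submatrix e e) i y = (marginal g i y).submatrix e e := by
      ext i j
      simp [marginal, Matrix.sum_apply]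
    rw [this, hm, tensorPow_one_eq]
    change (ρ.submatrix e e * _).trace = _
    rw [Matrix.submatrix_mul_equiv, trace_submatrix_equiv]

end Qubit

/-! ### Necessary conditions for one-copy and two-copy compatibility, by duality. -/

noncomputable section Bounds

theorem sum_dite_mem {α M : Type*} [Fintype α] [DecidableEq α] [AddCommMonoid M] (S : Finset α)
    (f : S → M) : ∑ i, (if h : i ∈ S then f ⟨i, h⟩ else 0) = ∑ v : S, f v := by
  rw [← Finset.sum_subset (Finset.subset_univ S) fun i _ hi => dif_neg hi, ← Finset.sum_coe_sort S]
  exact Finset.sum_congr rfl fun v _ => dif_pos v.2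

/-- The score rewards agreement of the outcome `y` with the sign `s` of the prepared eigenstate; the
constant half of each probability cancels. -/
theorem sum_score_noisySpin (i : Fin 3) (w t : ℝ) :
    ∑ s : ℤˣ, ∑ y : ℤˣ, (((s : ℤ) : ℂ) * ((y : ℤ) : ℂ) * w) *
      (noisySpin (pauli i) 1 s * noisySpin (pauli i) t y).trace = ((2 * w * t : ℝ) : ℂ) := by
  simp only [trace_noisySpin_mul]
  simp [UnitsInt.univ]
  ring

/-- Score with weights r_v. For outcome x the score operator is ∑ x_v r_v σ_v, of norm √N, so √N·1
dominates it. Duality then reads 2N ≤ 2√N. -/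
theorem sum_sq_le_one_of_kCompatible_one {r : Fin 3 → ℝ} {S : Finset (Fin 3)}
    (h : KCompatible 1 (fun v : S => noisySpin (pauli v) (r v))) : ∑ i ∈ S, r i ^ 2 ≤ 1 := by
  set N := ∑ i ∈ S, r i ^ 2 with hN
  -- The case N = 0 is split off because `posSemidef_bloch` needs √N > 0.
  rcases (show 0 ≤ N from Finset.sum_nonneg fun i _ => sq_nonneg _).eq_or_lt with h0 | h0
  · rw [← h0]; exact zero_le_one
  have key := h.score_le (J := ℤˣ) (ρ := fun v s => noisySpin (pauli v) 1 s)
    (fun v s => isState_noisySpin_one v s)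
    (fun v s y => ((s : ℤ) : ℂ) * ((y : ℤ) : ℂ) * (r v : ℂ)) ((√N : ℂ) • 1) (fun x => by
      -- This is the gap between the dual operator and the score operator: the Bloch vector −x_v
      -- r_v, extended by zero outside `S`.
      have hb : (bloch (√N) (fun i => if h : i ∈ S then -(((x ⟨i, h⟩ : ℤ) : ℝ) * r i) else 0)
          ).PosSemidef := by
        refine posSemidef_bloch (Real.sqrt_pos.mpr h0) ?_
        rw [Real.sq_sqrt h0.le, hN, ← Finset.sum_coe_sort S, ← sum_dite_mem S]
        refine (Finset.sum_congr rfl fun i _ => ?_).le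
        split_ifs
        · rw [neg_sq, mul_pow, units_cast_sq, one_mul]
        · simp
      convert hb.submatrix (fun f : Fin 1 → Fin 2 => f 0) using 1
      have h1 : ∀ v : S, ∑ s : ℤˣ, (((s : ℤ) : ℂ) * ((x v : ℤ) : ℂ) * (r v : ℂ)) •
          tensorPow 1 (noisySpin (pauli v) 1 s) =
          ((((x v : ℤ) : ℂ) * (r v : ℂ)) • pauli v).submatrix (fun f => f 0) (fun f => f 0) := by
        intro v
        rw [UnitsInt.univ, Finset.sum_pair (by decide)]
        ext j k
        simp [tensorPow_one_eq, noisySpin]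
        ring
      have h2 : ∑ i, (((if h : i ∈ S then -(((x ⟨i, h⟩ : ℤ) : ℝ) * r i) else 0 : ℝ)) : ℂ) •
          pauli i = - ∑ v : S, (((x v : ℤ) : ℂ) * (r v : ℂ)) • pauli v := by
        rw [← Finset.sum_neg_distrib, ← sum_dite_mem S]
        refine Finset.sum_congr rfl fun i _ => ?_
        split_ifs <;> simp
      rw [Finset.sum_congr rfl fun v _ => h1 v, bloch, h2]
      ext j k
      have hjk : j = k ↔ j 0 = k 0 :=
        ⟨fun h => h ▸ rfl, fun h => funext fun i => by rwa [Subsingleton.elim i 0]⟩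
      simp [Matrix.sum_apply, Matrix.one_apply, hjk, sub_eq_add_neg])
  rw [Finset.sum_congr rfl fun (v : S) _ => sum_score_noisySpin v (r v) (r v)] at key
  rw [← Complex.ofReal_sum, Finset.sum_coe_sort S (fun i => 2 * r i * r i)] at key
  have h3 : ∑ i ∈ S, 2 * r i * r i = 2 * N := by
    rw [hN, Finset.mul_sum]
    exact Finset.sum_congr rfl fun i _ => by ring
  have h4 : ((√N : ℂ) • (1 : Matrix (Fin 1 → Fin 2) (Fin 1 → Fin 2) ℂ)).trace =
      ((2 * √N : ℝ) : ℂ) := by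
    simp [Matrix.trace_smul, mul_comm]
  rw [h3, h4, Complex.real_le_real] at key
  have h5 := Real.sq_sqrt h0.le
  have h6 := Real.sqrt_pos.mpr h0
  nlinarith

/-- The projection onto the symmetric subspace of `ℂ² ⊗ ℂ²`. -/
def symProj : Matrix (Fin 2 × Fin 2) (Fin 2 × Fin 2) ℂ :=
  Matrix.of fun p q => ((if p = q then 1 else 0) + (if p = q.swap then 1 else 0)) / 2

theorem isHermitian_symProj : symProj.IsHermitian := by
  ext p q
  obtain ⟨i, j⟩ := p
  obtain ⟨k, l⟩ := q
  fin_cases i <;> fin_cases j <;> fin_cases k <;> fin_cases l <;> simp [symProj]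

theorem trace_symProj : symProj.trace = 3 := by
  simp [Matrix.trace, symProj, Fintype.sum_prod_type]
  norm_num

theorem tensorPow_two_eq (A : Matrix (Fin 2) (Fin 2) ℂ) :
    tensorPow 2 A = (A ⊗ₖ A).submatrix (finTwoArrowEquiv _) (finTwoArrowEquiv _) := by
  ext i j
  simp [tensorPow]

/-- The terms even in s, 1 ⊗ 1 and σ ⊗ σ, cancel; only the total spin survives. -/
theorem sum_sign_smul_tensor_noisySpin (σ : Matrix (Fin 2) (Fin 2) ℂ) :
    ∑ s : ℤˣ, ((s : ℤ) : ℂ) • (noisySpin σ 1 s ⊗ₖ noisySpin σ 1 s) =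
      (1 / 2 : ℂ) • (1 ⊗ₖ σ + σ ⊗ₖ 1) := by
  rw [UnitsInt.univ, Finset.sum_pair (by decide)]
  ext p q
  simp [noisySpin]
  ring

/-- Compression to the symmetric subspace symmetrizes v·σ ⊗ 1 to half the total spin. No projection
is left on that term because total spin vanishes on the singlet. -/
theorem symProj_conj_bloch (t : ℝ) (v : Fin 3 → ℝ) :
    symProj * (bloch t v ⊗ₖ 1) * symProj =
      (t : ℂ) • symProj + (1 / 2 : ℂ) • (1 ⊗ₖ bloch 0 v + bloch 0 v ⊗ₖ 1) := by
  simp only [bloch_eq]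
  ext p q
  obtain ⟨i, j⟩ := p
  obtain ⟨k, l⟩ := q
  fin_cases i <;> fin_cases j <;> fin_cases k <;> fin_cases l <;>
    simp [Matrix.mul_apply, Fintype.sum_prod_type, symProj] <;> ring

/-- Score with unit weights and take √3·P as dual operator, P being `symProj`. The gap for outcome x
is P((√3 − x·σ) ⊗ 1)P, which is positive since |x| = √3. Using P instead of the identity lowers the
trace from 4√3 to 3√3. -/
theorem sum_le_of_kCompatible_two {r : Fin 3 → ℝ}
    (h : KCompatible 2 (fun i : Fin 3 => noisySpin (pauli i) (r i))) :
    2 * ∑ i, r i ≤ 3 * √3 := by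
  have key := h.score_le (J := ℤˣ) (ρ := fun v s => noisySpin (pauli v) 1 s)
    (fun v s => isState_noisySpin_one v s)
    (fun v s y => ((s : ℤ) : ℂ) * ((y : ℤ) : ℂ) * ((1 : ℝ) : ℂ))
    (((√3 : ℂ) • symProj).submatrix (finTwoArrowEquiv _) (finTwoArrowEquiv _)) (fun x => by
      have hb : (bloch (√3) (fun i => -((x i : ℤ) : ℝ))).PosSemidef :=
        posSemidef_bloch (by positivity) (by simp [units_cast_sq])
      have hc := ((hb.kronecker PosSemidef.one).mul_mul_conjTranspose_same symProj).submatrix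
        (finTwoArrowEquiv (Fin 2))
      rw [isHermitian_symProj.eq, symProj_conj_bloch] at hc
      refine Eq.mpr (congrArg Matrix.PosSemidef ?_) hc
      have h1 : ∑ i : Fin 3, ∑ s : ℤˣ, (((s : ℤ) : ℂ) * ((x i : ℤ) : ℂ) * ((1 : ℝ) : ℂ)) •
          tensorPow 2 (noisySpin (pauli i) 1 s) =
          (-((1 / 2 : ℂ) • (1 ⊗ₖ bloch 0 (fun i => -((x i : ℤ) : ℝ)) +
            bloch 0 (fun i => -((x i : ℤ) : ℝ)) ⊗ₖ 1))).submatrix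
              (finTwoArrowEquiv (Fin 2)) (finTwoArrowEquiv (Fin 2)) := by
        have h2 : ∀ i, ∑ s : ℤˣ, (((s : ℤ) : ℂ) * ((x i : ℤ) : ℂ) * ((1 : ℝ) : ℂ)) •
            tensorPow 2 (noisySpin (pauli i) 1 s) = (((x i : ℤ) : ℂ) •
              (1 / 2 : ℂ) • (1 ⊗ₖ pauli i + pauli i ⊗ₖ 1)).submatrix
              (finTwoArrowEquiv (Fin 2)) (finTwoArrowEquiv (Fin 2)) := by
          intro i
          rw [← sum_sign_smul_tensor_noisySpin, Finset.smul_sum]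
          simp only [tensorPow_two_eq]
          ext j k
          simp [Matrix.sum_apply]
        rw [Finset.sum_congr rfl fun i _ => h2 i]
        ext j k
        simp [Matrix.sum_apply, bloch, Fin.sum_univ_three]
        ring
      rw [h1]
      ext j k
      simp
      ring)
  rw [Finset.sum_congr rfl fun (v : Fin 3) _ => sum_score_noisySpin v 1 (r v),
    trace_submatrix_equiv, Matrix.trace_smul, trace_symProj, ← Complex.ofReal_sum] at key
  have h3 : (√3 : ℂ) • (3 : ℂ) = ((3 * √3 : ℝ) : ℂ) := by simp [mul_comm]
  rw [h3, Complex.real_le_real] at key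
  simpa [Finset.mul_sum] using key

end Bounds

/-! ### Combinatorial classification of the stacks on three vertices. -/

section Stacks

variable {V W U : Type*} [Fintype V] [DecidableEq V] [Fintype W] [DecidableEq W]
  [Fintype U] [DecidableEq U] {n : ℕ}

/-- Relabelling of the vertices of a stack. -/
def CompatibilityStack.reindex (H : CompatibilityStack V n) (e : V ≃ W) :
    CompatibilityStack W n where
  E k := {S | S.map e.symm.toEmbedding ∈ H.E k}
  card_eq := (Fintype.card_congr e.symm).trans H.card_eq
  nonempty_of_mem k S hS := by simpa using H.nonempty_of_mem k _ (Finset.mem_filter.mp hS).2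
  mem_of_subset k S hS T hT hne := by
    simp only [Finset.mem_filter, Finset.mem_univ, true_and] at hS ⊢
    exact H.mem_of_subset k _ hS _ (Finset.map_subset_map.mpr hT) (by simpa using hne)
  singleton_mem k hk v := by simpa using H.singleton_mem k hk (e.symm v)
  mem_last k hk S hS := by simpa using H.mem_last k hk _ (by simpa using hS)
  union_mem k l m h S hS T hT := by
    simp only [Finset.mem_filter, Finset.mem_univ, true_and, Finset.map_union] at hS hT ⊢
    exact H.union_mem k l m h _ hS _ hT

theorem CompatibilityStack.mem_iff_map_mem_reindex (H : CompatibilityStack V n) (e : V ≃ W) (k : Fin n)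
    (S : Finset V) : S ∈ H.E k ↔ S.map e.toEmbedding ∈ (H.reindex e).E k := by
  simp [reindex, Finset.map_map]

theorem CompatibilityStack.Iso.trans {H : CompatibilityStack V n} {K : CompatibilityStack W n}
    {L : CompatibilityStack U n} (h : H.Iso K) (h' : K.Iso L) : H.Iso L := by
  obtain ⟨e, he⟩ := h
  obtain ⟨f, hf⟩ := h'
  refine ⟨e.trans f, fun k S => ?_⟩
  rw [he, hf, Finset.map_map, Equiv.trans_toEmbedding]

theorem CompatibilityStack.Iso.card_eq {H : CompatibilityStack V n} {K : CompatibilityStack W n}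
    (h : H.Iso K) (k : Fin n) : (H.E k).card = (K.E k).card := by
  obtain ⟨e, he⟩ := h
  refine Finset.card_bij (fun S _ => S.map e.toEmbedding) (fun S hS => (he k S).mp hS)
    (fun S _ T _ h => Finset.map_injective _ h) fun T hT => ?_
  have hT' : (T.map e.symm.toEmbedding).map e.toEmbedding = T := by
    simp [Finset.map_map]
  exact ⟨T.map e.symm.toEmbedding, (he k _).mpr (hT'.symm ▸ hT), hT'⟩

theorem CompatibilityStack.RealizedBy.of_reindex {H : CompatibilityStack V n} {e : V ≃ W}
    {d Ω : Type*} [Fintype d] [DecidableEq d] [Fintype Ω] [DecidableEq Ω]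
    {A : W → Ω → Matrix d d ℂ} (h : (H.reindex e).RealizedBy A) :
    H.RealizedBy (fun v => A (e v)) := by
  obtain ⟨h1, h2, h3⟩ := h
  refine ⟨fun v => h1 _, h2.comp e.injective, fun k S => ?_⟩
  rw [H.mem_iff_map_mem_reindex e, h3, Finset.map_nonempty]
  refine and_congr_right fun _ => ⟨fun h => ?_, fun h => ?_⟩
  · exact h.comp fun v : S =>
      (⟨e v, Finset.mem_map_of_mem _ v.2⟩ : (S.map e.toEmbedding : Finset W))
  · have := h.comp fun w : (S.map e.toEmbedding : Finset W) =>
      (⟨e.symm w, by obtain ⟨v, hv, h⟩ := Finset.mem_map.mp w.2; simpa [← h] using hv⟩ : S)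
    simpa using this

/-- The two lowest levels of the stacks on the vertex set `{0, 1, 2}`. -/
def lowLevels : Finset (Finset (Finset (Fin 3)) × Finset (Finset (Fin 3))) :=
  {(allSubsets, allSubsets),
   ({{0}, {1}, {2}, {0, 1}, {0, 2}, {1, 2}}, allSubsets),
   ({{0}, {1}, {2}, {0, 2}, {1, 2}}, allSubsets),
   ({{0}, {1}, {2}, {0, 1}, {1, 2}}, allSubsets),
   ({{0}, {1}, {2}, {0, 1}, {0, 2}}, allSubsets),
   ({{0}, {1}, {2}, {0, 2}}, allSubsets),
   ({{0}, {1}, {2}, {1, 2}}, allSubsets),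
   ({{0}, {1}, {2}, {0, 1}}, allSubsets),
   ({{0}, {1}, {2}}, allSubsets),
   ({{0}, {1}, {2}}, {{0}, {1}, {2}, {0, 1}, {0, 2}, {1, 2}})}

theorem finset_fin_three_cases : ∀ S : Finset (Fin 3), S.Nonempty → S = {0} ∨ S = {1} ∨ S = {2} ∨
    S = {0, 1} ∨ S = {0, 2} ∨ S = {1, 2} ∨ S = {0, 1, 2} := by
  decide +kernel

/-- All singletons, and those of the sets `{0, 1}`, `{0, 2}`, `{1, 2}`, `{0, 1, 2}` that are
switched on. -/
def edges (p q r t : Bool) : Finset (Finset (Fin 3)) :=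
  {{0}, {1}, {2}} ∪ (if p then {{0, 1}} else ∅) ∪ (if q then {{0, 2}} else ∅) ∪
    (if r then {{1, 2}} else ∅) ∪ (if t then {{0, 1, 2}} else ∅)

theorem mem_edges : ∀ p q r t : Bool, ({0, 1} ∈ edges p q r t ↔ p) ∧ ({0, 2} ∈ edges p q r t ↔ q) ∧
    ({1, 2} ∈ edges p q r t ↔ r) ∧ ({0, 1, 2} ∈ edges p q r t ↔ t) ∧
    (∀ v, {v} ∈ edges p q r t) ∧ ∅ ∉ edges p q r t := by
  decide +kernel

theorem eq_edges {E : Finset (Finset (Fin 3))} (h : ∀ S ∈ E, S.Nonempty) (hs : ∀ v, {v} ∈ E) :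
    E = edges (decide ({0, 1} ∈ E)) (decide ({0, 2} ∈ E)) (decide ({1, 2} ∈ E))
      (decide ({0, 1, 2} ∈ E)) := by
  obtain ⟨h1, h2, h3, h4, h5, h6⟩ := mem_edges (decide ({0, 1} ∈ E)) (decide ({0, 2} ∈ E))
    (decide ({1, 2} ∈ E)) (decide ({0, 1, 2} ∈ E))
  ext S
  rcases S.eq_empty_or_nonempty with rfl | hS
  · exact iff_of_false (fun hE => Finset.not_nonempty_empty (h _ hE)) h6
  rcases finset_fin_three_cases S hS with rfl | rfl | rfl | rfl | rfl | rfl | rfl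
  · exact iff_of_true (hs _) (h5 _)
  · exact iff_of_true (hs _) (h5 _)
  · exact iff_of_true (hs _) (h5 _)
  · rw [h1, decide_eq_true_iff]
  · rw [h2, decide_eq_true_iff]
  · rw [h3, decide_eq_true_iff]
  · rw [h4, decide_eq_true_iff]

/-- The two hypotheses on the Booleans are what (S1) and (S3) impose; the claim is then a finite
check. -/
theorem edges_mem_lowLevels : ∀ p q r t u : Bool, (t → p ∧ q ∧ r) ∧ (p ∨ q ∨ r → u) →
    (edges p q r t, edges true true true u) ∈ lowLevels := by
  decide +kernel

theorem CompatibilityStack.eq_of_lowLevels (H : CompatibilityStack (Fin 3) 3) :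
    ∃ p ∈ lowLevels, H.E = ![p.1, p.2, allSubsets] := by
  -- Indices are shifted: `H.E 0` is E_1 and `H.E 1` is E_2.
  have hs := H.singleton_mem 0 rfl
  have hu := H.union_mem 0 0 1 rfl
  have h01 : {0, 1} ∈ H.E 1 := hu _ (hs 0) _ (hs 1)
  have h02 : {0, 2} ∈ H.E 1 := hu _ (hs 0) _ (hs 2)
  have h12 : {1, 2} ∈ H.E 1 := hu _ (hs 1) _ (hs 2)
  have e0 := eq_edges (H.nonempty_of_mem 0) hs
  have e1 := eq_edges (H.nonempty_of_mem 1) (fun v => by simpa using hu _ (hs v) _ (hs v))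
  simp only [h01, h02, h12, decide_true] at e1
  refine ⟨(H.E 0, H.E 1), ?_, ?_⟩
  · rw [e0, e1]
    refine edges_mem_lowLevels _ _ _ _ _ ⟨fun h => ?_, fun h => ?_⟩
    · simp only [decide_eq_true_iff] at h ⊢
      have hm := H.mem_of_subset 0 _ h
      exact ⟨hm _ (by decide) (by simp), hm _ (by decide) (by simp), hm _ (by decide) (by simp)⟩
    · simp only [decide_eq_true_iff] at h ⊢
      rcases h with h | h | h
      · exact hu _ h _ (hs 2)
      · simpa [Finset.insert_comm] using hu _ (hs 1) _ h
      · exact hu _ (hs 0) _ h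
  · funext k
    fin_cases k
    · rfl
    · rfl
    · ext S
      have h : ∀ S : Finset (Fin 3), S ∈ allSubsets ↔ S.Nonempty := by decide +kernel
      exact ⟨fun hS => (h S).mpr (H.nonempty_of_mem 2 S hS),
        fun hS => H.mem_last 2 rfl S ((h S).mp hS)⟩

theorem exists_perm_of_lowLevels (p) (hp : p ∈ lowLevels) :
    ∃ j : Fin 6, ∃ e : Equiv.Perm (Fin 3),
      ∀ k : Fin 3, ∀ S : Finset (Fin 3), S ∈ (![p.1, p.2, allSubsets] : Fin 3 → _) k ↔
        S.map e.toEmbedding ∈ (sixStacks j).E k := by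
  -- In the permuted cases the transposition moves the missing pair to {0, 1} for (c), or the only
  -- pair to {0, 2} for (d).
  simp only [lowLevels, Finset.mem_insert, Finset.mem_singleton] at hp
  rcases hp with rfl | rfl | rfl | rfl | rfl | rfl | rfl | rfl | rfl | rfl
  · exact ⟨0, 1, by decide +kernel⟩
  · exact ⟨1, 1, by decide +kernel⟩
  · exact ⟨2, 1, by decide +kernel⟩
  · exact ⟨2, Equiv.swap 1 2, by decide +kernel⟩
  · exact ⟨2, Equiv.swap 0 2, by decide +kernel⟩
  · exact ⟨3, 1, by decide +kernel⟩
  · exact ⟨3, Equiv.swap 0 1, by decide +kernel⟩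
  · exact ⟨3, Equiv.swap 1 2, by decide +kernel⟩
  · exact ⟨4, 1, by decide +kernel⟩
  · exact ⟨5, 1, by decide +kernel⟩

/-- E_1 has 7, 6, 5, 4, 3, 3 members; the tie between (e) and (f) is broken by E_2, with 7 against
6. -/
theorem sixStacks_card_injective : ∀ i j : Fin 6,
    ((sixStacks i).E 0).card = ((sixStacks j).E 0).card →
    ((sixStacks i).E 1).card = ((sixStacks j).E 1).card → i = j := by
  decide +kernel

theorem CompatibilityStack.existsUnique_iso (H : CompatibilityStack V 3) :
    ∃! j : Fin 6, H.Iso (sixStacks j) := by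
  have e : V ≃ Fin 3 := Fintype.equivFinOfCardEq H.card_eq
  obtain ⟨p, hp, hE⟩ := (H.reindex e).eq_of_lowLevels
  obtain ⟨j, f, hf⟩ := exists_perm_of_lowLevels p hp
  have h1 : H.Iso (H.reindex e) := ⟨e, H.mem_iff_map_mem_reindex e⟩
  have h2 : (H.reindex e).Iso (sixStacks j) := ⟨f, fun k S => by rw [hE]; exact hf k S⟩
  have hj := h1.trans h2
  refine ⟨j, hj, fun i hi => ?_⟩
  exact sixStacks_card_injective i j ((hi.card_eq 0).symm.trans (hj.card_eq 0))
    ((hi.card_eq 1).symm.trans (hj.card_eq 1))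

end Stacks

/-! ### Realizing every stack by spin observables. -/

section Realizations

theorem kCompatible_one_iff {r : Fin 3 → ℝ} {S : Finset (Fin 3)} :
    KCompatible 1 (fun v : S => noisySpin (pauli v) (r v)) ↔ ∑ i ∈ S, r i ^ 2 ≤ 1 := by
  refine ⟨sum_sq_le_one_of_kCompatible_one, fun h => ?_⟩
  -- Set the parameters outside `S` to 0, jointly measure all three observables, and keep those in
  -- `S`.
  have h' := (kCompatible_one_noisySpin (r := fun i => if i ∈ S then r i else 0)
    (by simpa [ite_pow, Finset.sum_ite_mem] using h)).comp fun v : S => (v : Fin 3)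
  simpa using h'

theorem kCompatible_univ_iff {k : ℕ} {A : Fin 3 → ℤˣ → Matrix (Fin 2) (Fin 2) ℂ} :
    KCompatible k (fun v : (Finset.univ : Finset (Fin 3)) => A v) ↔ KCompatible k A :=
  ⟨fun h => h.comp fun i => (⟨i, Finset.mem_univ i⟩ : (Finset.univ : Finset (Fin 3))),
    fun h => h.comp _⟩

theorem trace_pauli_mul_of_ne {i j : Fin 3} (h : i ≠ j) : (pauli i * pauli j).trace = 0 := by
  fin_cases i <;> fin_cases j <;>
    simp_all [pauli, pauliX, pauliY, pauliZ, Matrix.trace, Fin.sum_univ_two]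

/-- On the +1 eigenstate of `pauli i`, outcome +1 has probability (1 + r_i)/2 for observable i but
1/2 for any other. -/
theorem noisySpin_pauli_injective {r : Fin 3 → ℝ} (hr : ∀ i, 0 < r i) :
    Function.Injective fun i => noisySpin (pauli i) (r i) := by
  intro i j hij
  by_contra hne
  have h := congrArg (fun M => (noisySpin (pauli i) 1 1 * M).trace) (congrFun hij 1)
  have hz : (pauli i * pauli j).trace = 0 := trace_pauli_mul_of_ne hne
  simp only [trace_noisySpin_mul] at h
  simp [noisySpin, Matrix.add_mul, Matrix.mul_add, trace_pauli, hz] at h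
  have h0 : (r i : ℂ) = 0 := by linear_combination 2 * h
  exact (hr i).ne' (by exact_mod_cast h0)

theorem kCompatible_two_of_pair {r : Fin 3 → ℝ} (hr : ∀ i, r i ^ 2 ≤ 1) {i j : Fin 3}
    (hij : i ≠ j) (h : r i ^ 2 + r j ^ 2 ≤ 1) :
    KCompatible 2 (fun i => noisySpin (pauli i) (r i)) := by
  have hk : ∃ k, ({i, j} ∪ {k} : Finset (Fin 3)) = Finset.univ := by
    clear h
    decide +revert
  obtain ⟨k, hk⟩ := hk
  have h1 : KCompatible 1 (fun v : ({i, j} : Finset (Fin 3)) => noisySpin (pauli v) (r v)) :=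
    kCompatible_one_iff.mpr (by rwa [Finset.sum_pair hij])
  have h2 : KCompatible 1 (fun v : ({k} : Finset (Fin 3)) => noisySpin (pauli v) (r v)) :=
    kCompatible_one_iff.mpr (by simpa using hr k)
  have h3 := KCompatible.union (A := fun i => noisySpin (pauli i) (r i)) h1 h2
  rw [hk] at h3
  exact kCompatible_univ_iff.mp h3

/-- Only E_1 and the triple in E_2 need checking: the remaining memberships and compatibilities hold
on both sides by taking unions of singletons. -/
theorem realizedBy_noisySpin (H : CompatibilityStack (Fin 3) 3) {r : Fin 3 → ℝ}
    (hr : ∀ i, 0 < r i) (hr' : ∀ i, r i ^ 2 ≤ 1)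
    (h0 : ∀ S : Finset (Fin 3), S.Nonempty → (S ∈ H.E 0 ↔ ∑ i ∈ S, r i ^ 2 ≤ 1))
    (h1 : Finset.univ ∈ H.E 1 ↔ KCompatible 2 (fun i => noisySpin (pauli i) (r i))) :
    H.RealizedBy (fun i => noisySpin (pauli i) (r i)) := by
  refine ⟨fun i => isObservable_noisySpin i (hr' i), noisySpin_pauli_injective hr, ?_⟩
  have hs : ∀ i, KCompatible 1
      (fun v : ({i} : Finset (Fin 3)) => noisySpin (pauli v) (r v)) := fun i =>
    kCompatible_one_iff.mpr (by simpa using hr' i)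
  have hu : ∀ i j, KCompatible 2
      (fun v : ({i} ∪ {j} : Finset (Fin 3)) => noisySpin (pauli v) (r v)) := fun i j =>
    KCompatible.union (A := fun i => noisySpin (pauli i) (r i)) (hs i) (hs j)
  intro k S
  suffices hS : S.Nonempty → (S ∈ H.E k ↔
      KCompatible ((k : ℕ) + 1) (fun v : S => noisySpin (pauli v) (r v))) from
    ⟨fun h => ⟨H.nonempty_of_mem k S h, (hS (H.nonempty_of_mem k S h)).mp h⟩,
      fun h => (hS h.1).mpr h.2⟩
  intro hS
  match k with
  | 0 => rw [h0 S hS]; exact kCompatible_one_iff.symm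
  | 1 =>
    by_cases hSu : S = Finset.univ
    · subst hSu
      rw [h1]
      exact kCompatible_univ_iff.symm
    · have : ∃ i j, S = {i} ∪ {j} := by
        clear h0 h1
        decide +revert
      obtain ⟨i, j, rfl⟩ := this
      exact iff_of_true (H.union_mem 0 0 1 rfl _ (H.singleton_mem 0 rfl i) _
        (H.singleton_mem 0 rfl j)) (hu i j)
  | 2 =>
    refine iff_of_true (H.mem_last 2 rfl S hS) ?_
    have h3 := KCompatible.union (A := fun i => noisySpin (pauli i) (r i)) (hu 0 1) (hs 2)
    exact h3.mono (A := fun i => noisySpin (pauli i) (r i)) (by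
      intro i _
      fin_cases i <;> simp)

theorem realizedBy_spinTriple (H : CompatibilityStack (Fin 3) 3) {a b c : ℝ}
    (ha : 0 < a) (hb : 0 < b) (hc : 0 < c) (ha' : a ≤ 1) (hb' : b ≤ 1) (hc' : c ≤ 1)
    (h01 : {0, 1} ∈ H.E 0 ↔ a ^ 2 + b ^ 2 ≤ 1) (h02 : {0, 2} ∈ H.E 0 ↔ a ^ 2 + c ^ 2 ≤ 1)
    (h12 : {1, 2} ∈ H.E 0 ↔ b ^ 2 + c ^ 2 ≤ 1)
    (h012 : {0, 1, 2} ∈ H.E 0 ↔ a ^ 2 + b ^ 2 + c ^ 2 ≤ 1)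
    (h1 : {0, 1, 2} ∈ H.E 1 ↔ KCompatible 2 (spinTriple a b c)) :
    H.RealizedBy (spinTriple a b c) := by
  have hA : spinTriple a b c = fun i => noisySpin (pauli i) (![a, b, c] i) :=
    funext fun i => spinTriple_apply a b c i
  rw [hA] at h1 ⊢
  have hr' : ∀ i, ![a, b, c] i ^ 2 ≤ 1 := by
    intro i
    fin_cases i
    · exact pow_le_one₀ ha.le ha'
    · exact pow_le_one₀ hb.le hb'
    · exact pow_le_one₀ hc.le hc'
  refine realizedBy_noisySpin H (fun i => ?_) hr' (fun S hS => ?_) h1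
  · fin_cases i <;> simpa
  · have hsing := H.singleton_mem 0 rfl
    rcases finset_fin_three_cases S hS with rfl | rfl | rfl | rfl | rfl | rfl | rfl
    · simpa [hsing] using hr' 0
    · simpa [hsing] using hr' 1
    · simpa [hsing] using hr' 2
    · rw [h01]; simp
    · rw [h02]; simp
    · rw [h12]; simp
    · rw [h012]; simp [add_assoc]

theorem realizedBy_spinTriple_of_pair (H : CompatibilityStack (Fin 3) 3) {a b c : ℝ}
    (ha : 0 < a) (hb : 0 < b) (hc : 0 < c) (ha' : a ≤ 1) (hb' : b ≤ 1) (hc' : c ≤ 1)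
    (h01 : {0, 1} ∈ H.E 0 ↔ a ^ 2 + b ^ 2 ≤ 1) (h02 : {0, 2} ∈ H.E 0 ↔ a ^ 2 + c ^ 2 ≤ 1)
    (h12 : {1, 2} ∈ H.E 0 ↔ b ^ 2 + c ^ 2 ≤ 1)
    (h012 : {0, 1, 2} ∈ H.E 0 ↔ a ^ 2 + b ^ 2 + c ^ 2 ≤ 1)
    (hp : a ^ 2 + b ^ 2 ≤ 1 ∨ a ^ 2 + c ^ 2 ≤ 1 ∨ b ^ 2 + c ^ 2 ≤ 1) :
    H.RealizedBy (spinTriple a b c) := by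
  have hr' : ∀ i, ![a, b, c] i ^ 2 ≤ 1 := by
    intro i
    fin_cases i
    · exact pow_le_one₀ ha.le ha'
    · exact pow_le_one₀ hb.le hb'
    · exact pow_le_one₀ hc.le hc'
  refine realizedBy_spinTriple H ha hb hc ha' hb' hc' h01 h02 h12 h012 (iff_of_true ?_ ?_)
  · have hsing := H.singleton_mem 0 rfl
    have hun := H.union_mem 0 0 1 rfl
    rcases hp with hp | hp | hp
    · simpa using hun _ (h01.mpr hp) _ (hsing 2)
    · simpa using hun _ (hsing 1) _ (h02.mpr hp)
    · exact hun _ (hsing 0) _ (h12.mpr hp)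
  · rw [show spinTriple a b c = fun i => noisySpin (pauli i) (![a, b, c] i) from
      funext fun i => spinTriple_apply a b c i]
    rcases hp with hp | hp | hp
    · exact kCompatible_two_of_pair hr' (i := 0) (j := 1) (by decide) (by simpa using hp)
    · exact kCompatible_two_of_pair hr' (i := 0) (j := 2) (by decide) (by simpa using hp)
    · exact kCompatible_two_of_pair hr' (i := 1) (j := 2) (by decide) (by simpa using hp)

/-- Let one observable be sharp on one copy and the other two have parameter 1/√2 on the other copy.
Averaging over which one is sharp gives (1 + 2/√2)/3 = (1 + √2)/3 for each. -/
theorem kCompatible_two_spinTriple_mixture :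
    KCompatible 2 (spinTriple ((1 + √2) / 3) ((1 + √2) / 3) ((1 + √2) / 3)) := by
  have h2 : (√2)⁻¹ ^ 2 = 1 / 2 := by rw [inv_pow, Real.sq_sqrt (by norm_num)]; norm_num
  have hj : ∀ j : Fin 3, KCompatible 2
      (fun i => noisySpin (pauli i) (if i = j then 1 else (√2)⁻¹)) := by
    intro j
    have hkl : ∃ k l : Fin 3, k ≠ l ∧ k ≠ j ∧ l ≠ j := by decide +revert
    obtain ⟨k, l, hkl, hk, hl⟩ := hkl
    refine kCompatible_two_of_pair (fun i => ?_) hkl ?_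
    · split_ifs <;> norm_num [h2]
    · norm_num [hk, hl, h2]
  have h := KCompatible.mix hj (p := fun _ => 1 / 3) (by norm_num) (by simp)
  convert h using 1
  funext i s
  have h2' : (√2)⁻¹ = √2 / 2 := by
    field_simp
    exact (Real.sq_sqrt (by norm_num)).symm
  simp only [h2']
  rw [spinTriple_apply]
  fin_cases i <;>
  · ext j k
    simp [Fin.sum_univ_three, noisySpin, Matrix.add_apply]
    ring

/-- Stated through `H.E`, here and for the other stacks, so that it serves both the named stack and
an arbitrary `H` with these edges. -/
theorem realizedBy_of_E_eq_a {H : CompatibilityStack (Fin 3) 3}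
    (hE : H.E = ![allSubsets, allSubsets, allSubsets]) :
    H.RealizedBy (spinTriple (1 / √3) (1 / √3) (1 / √3)) := by
  have h2 : (1 / √3) ^ 2 = 1 / 3 := by rw [div_pow, Real.sq_sqrt (by norm_num)]; norm_num
  have h0 : 0 < 1 / √3 := by positivity
  have h1 : 1 / √3 ≤ 1 := by nlinarith
  refine realizedBy_spinTriple_of_pair H h0 h0 h0 h1 h1 h1 ?_ ?_ ?_ ?_ (Or.inl ?_) <;>
    simp only [hE, h2]
  iterate 4 exact iff_of_true (by decide) (by norm_num)
  norm_num

theorem realizedBy_of_E_eq_b {H : CompatibilityStack (Fin 3) 3}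
    (hE : H.E = ![{{0}, {1}, {2}, {0, 1}, {0, 2}, {1, 2}}, allSubsets, allSubsets]) :
    H.RealizedBy (spinTriple (1 / √2) (1 / √2) (1 / √2)) := by
  have h2 : (1 / √2) ^ 2 = 1 / 2 := by rw [div_pow, Real.sq_sqrt (by norm_num)]; norm_num
  have h0 : 0 < 1 / √2 := by positivity
  have h1 : 1 / √2 ≤ 1 := by nlinarith
  refine realizedBy_spinTriple_of_pair H h0 h0 h0 h1 h1 h1 ?_ ?_ ?_ ?_ (Or.inl ?_) <;>
    simp only [hE, h2]
  iterate 3 exact iff_of_true (by decide) (by norm_num)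
  · exact iff_of_false (by decide) (by norm_num)
  · norm_num

theorem realizedBy_of_E_eq_c {H : CompatibilityStack (Fin 3) 3}
    (hE : H.E = ![{{0}, {1}, {2}, {0, 2}, {1, 2}}, allSubsets, allSubsets]) :
    H.RealizedBy (spinTriple (4 / 5) (4 / 5) (3 / 5)) := by
  refine realizedBy_spinTriple_of_pair H (by norm_num) (by norm_num) (by norm_num) (by norm_num)
    (by norm_num) (by norm_num) ?_ ?_ ?_ ?_ (by norm_num) <;> rw [hE] <;>
  first
  | exact iff_of_true (by decide) (by norm_num)
  | exact iff_of_false (by decide) (by norm_num)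

theorem realizedBy_of_E_eq_d {H : CompatibilityStack (Fin 3) 3}
    (hE : H.E = ![{{0}, {1}, {2}, {0, 2}}, allSubsets, allSubsets]) :
    H.RealizedBy (spinTriple (4 / 5) 1 (3 / 5)) := by
  refine realizedBy_spinTriple_of_pair H (by norm_num) (by norm_num) (by norm_num) (by norm_num)
    (by norm_num) (by norm_num) ?_ ?_ ?_ ?_ (by norm_num) <;> rw [hE] <;>
  first
  | exact iff_of_true (by decide) (by norm_num)
  | exact iff_of_false (by decide) (by norm_num)

theorem realizedBy_of_E_eq_e {H : CompatibilityStack (Fin 3) 3}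
    (hE : H.E = ![{{0}, {1}, {2}}, allSubsets, allSubsets]) :
    H.RealizedBy (spinTriple ((1 + √2) / 3) ((1 + √2) / 3) ((1 + √2) / 3)) := by
  have hs : √2 ^ 2 = 2 := Real.sq_sqrt (by norm_num)
  have hs0 : 0 < √2 := by positivity
  have h0 : 0 < (1 + √2) / 3 := by positivity
  have h1 : (1 + √2) / 3 ≤ 1 := by nlinarith
  -- Squares above 1/2 make every pair, hence also the triple, fail 1-compatibility.
  have h2 : 1 / 2 < ((1 + √2) / 3) ^ 2 := by nlinarith
  refine realizedBy_spinTriple H h0 h0 h0 h1 h1 h1 ?_ ?_ ?_ ?_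
    (iff_of_true (by rw [hE]; decide) kCompatible_two_spinTriple_mixture) <;> simp only [hE]
  all_goals exact iff_of_false (by decide) (by linarith)

theorem realizedBy_of_E_eq_f {H : CompatibilityStack (Fin 3) 3}
    (hE : H.E = ![{{0}, {1}, {2}}, {{0}, {1}, {2}, {0, 1}, {0, 2}, {1, 2}}, allSubsets])
    {a : ℝ} (ha : √3 / 2 < a) (ha' : a ≤ 1) : H.RealizedBy (spinTriple a a a) := by
  have hs : √3 ^ 2 = 3 := Real.sq_sqrt (by norm_num)
  have hs0 : 0 < √3 := by positivity
  have h0 : 0 < a := by linarith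
  have h2 : 3 / 4 < a ^ 2 := by nlinarith
  refine realizedBy_spinTriple H h0 h0 h0 ha' ha' ha' ?_ ?_ ?_ ?_
    (iff_of_false (by rw [hE]; decide) fun h => ?_)
  · exact iff_of_false (by rw [hE]; decide) (by linarith)
  · exact iff_of_false (by rw [hE]; decide) (by linarith)
  · exact iff_of_false (by rw [hE]; decide) (by linarith)
  · exact iff_of_false (by rw [hE]; decide) (by linarith)
  -- The two-copy bound reads 6a ≤ 3√3, contradicting a > √3/2.
  · have h' := sum_le_of_kCompatible_two (r := ![a, a, a])
      (by simpa only [← spinTriple_apply] using h)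
    simp [Fin.sum_univ_three] at h'
    linarith

/-- Here the labels are fixed, so all ten labelled stacks are treated; the four extra ones permute
the parameters of (c) and (d). -/
theorem exists_realizedBy_spinTriple (H : CompatibilityStack (Fin 3) 3) :
    ∃ a ∈ Set.Icc (0 : ℝ) 1, ∃ b ∈ Set.Icc (0 : ℝ) 1, ∃ c ∈ Set.Icc (0 : ℝ) 1,
      H.RealizedBy (spinTriple a b c) := by
  suffices h : ∃ a b c : ℝ, (0 ≤ a ∧ a ≤ 1) ∧ (0 ≤ b ∧ b ≤ 1) ∧ (0 ≤ c ∧ c ≤ 1) ∧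
      H.RealizedBy (spinTriple a b c) by
    obtain ⟨a, b, c, ha, hb, hc, h⟩ := h
    exact ⟨a, ha, b, hb, c, hc, h⟩
  have hs2 : √2 ^ 2 = 2 := Real.sq_sqrt (by norm_num)
  have hs20 : 0 < √2 := by positivity
  obtain ⟨p, hp, hE⟩ := H.eq_of_lowLevels
  simp only [lowLevels, Finset.mem_insert, Finset.mem_singleton] at hp
  rcases hp with rfl | rfl | rfl | rfl | rfl | rfl | rfl | rfl | rfl | rfl
  · have h : 0 ≤ 1 / √3 ∧ 1 / √3 ≤ 1 :=
      ⟨by positivity, by rw [div_le_one (by positivity)]; exact Real.one_le_sqrt.mpr (by norm_num)⟩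
    exact ⟨_, _, _, h, h, h, realizedBy_of_E_eq_a hE⟩
  · have h : 0 ≤ 1 / √2 ∧ 1 / √2 ≤ 1 :=
      ⟨by positivity, by rw [div_le_one (by positivity)]; exact Real.one_le_sqrt.mpr (by norm_num)⟩
    exact ⟨_, _, _, h, h, h, realizedBy_of_E_eq_b hE⟩
  · exact ⟨_, _, _, by norm_num, by norm_num, by norm_num, realizedBy_of_E_eq_c hE⟩
  · refine ⟨4 / 5, 3 / 5, 4 / 5, by norm_num, by norm_num, by norm_num,
      realizedBy_spinTriple_of_pair H (by norm_num) (by norm_num) (by norm_num) (by norm_num)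
        (by norm_num) (by norm_num) ?_ ?_ ?_ ?_ (by norm_num)⟩ <;> rw [hE] <;>
    first
    | exact iff_of_true (by decide) (by norm_num)
    | exact iff_of_false (by decide) (by norm_num)
  · refine ⟨3 / 5, 4 / 5, 4 / 5, by norm_num, by norm_num, by norm_num,
      realizedBy_spinTriple_of_pair H (by norm_num) (by norm_num) (by norm_num) (by norm_num)
        (by norm_num) (by norm_num) ?_ ?_ ?_ ?_ (by norm_num)⟩ <;> rw [hE] <;>
    first
    | exact iff_of_true (by decide) (by norm_num)
    | exact iff_of_false (by decide) (by norm_num)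
  · exact ⟨_, _, _, by norm_num, by norm_num, by norm_num, realizedBy_of_E_eq_d hE⟩
  · refine ⟨1, 4 / 5, 3 / 5, by norm_num, by norm_num, by norm_num,
      realizedBy_spinTriple_of_pair H (by norm_num) (by norm_num) (by norm_num) (by norm_num)
        (by norm_num) (by norm_num) ?_ ?_ ?_ ?_ (by norm_num)⟩ <;> rw [hE] <;>
    first
    | exact iff_of_true (by decide) (by norm_num)
    | exact iff_of_false (by decide) (by norm_num)
  · refine ⟨4 / 5, 3 / 5, 1, by norm_num, by norm_num, by norm_num,
      realizedBy_spinTriple_of_pair H (by norm_num) (by norm_num) (by norm_num) (by norm_num)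
        (by norm_num) (by norm_num) ?_ ?_ ?_ ?_ (by norm_num)⟩ <;> rw [hE] <;>
    first
    | exact iff_of_true (by decide) (by norm_num)
    | exact iff_of_false (by decide) (by norm_num)
  · have h : 0 ≤ (1 + √2) / 3 ∧ (1 + √2) / 3 ≤ 1 := ⟨by positivity, by nlinarith⟩
    exact ⟨_, _, _, h, h, h, realizedBy_of_E_eq_e hE⟩
  · refine ⟨1, 1, 1, by norm_num, by norm_num, by norm_num, realizedBy_of_E_eq_f hE ?_ le_rfl⟩
    rw [div_lt_one (by norm_num), Real.sqrt_lt' (by norm_num)]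
    norm_num

end Realizations

end QStack

/-- (1) Every compatibility stack with three vertices agrees, up to a relabelling of the vertices,
with exactly one of the six stacks. (2) Every such stack is realized by noisy spin observables
`X_a, Y_b, Z_c`, whichever vertices are assigned to `X`, `Y`, `Z`. (3) Explicit parameters that
realize the six stacks. -/
theorem mainTheorem3 :
    (∀ (V : Type*) [Fintype V] [DecidableEq V] (H : QStack.CompatibilityStack V 3),
      (∃! j : Fin 6, H.Iso (QStack.sixStacks j)) ∧
      ∀ e : V ≃ Fin 3, ∃ a ∈ Set.Icc (0 : ℝ) 1, ∃ b ∈ Set.Icc (0 : ℝ) 1,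
        ∃ c ∈ Set.Icc (0 : ℝ) 1, H.RealizedBy (fun v => QStack.spinTriple a b c (e v))) ∧
    QStack.stackA.RealizedBy
      (QStack.spinTriple (1 / Real.sqrt 3) (1 / Real.sqrt 3) (1 / Real.sqrt 3)) ∧
    QStack.stackB.RealizedBy
      (QStack.spinTriple (1 / Real.sqrt 2) (1 / Real.sqrt 2) (1 / Real.sqrt 2)) ∧
    QStack.stackC.RealizedBy (QStack.spinTriple (4 / 5) (4 / 5) (3 / 5)) ∧
    QStack.stackD.RealizedBy (QStack.spinTriple (4 / 5) 1 (3 / 5)) ∧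
    QStack.stackE.RealizedBy
      (QStack.spinTriple ((1 + Real.sqrt 2) / 3) ((1 + Real.sqrt 2) / 3)
        ((1 + Real.sqrt 2) / 3)) ∧
    (∀ a : ℝ, Real.sqrt 3 / 2 < a → a ≤ 1 →
      QStack.stackF.RealizedBy (QStack.spinTriple a a a)) := by
  refine ⟨fun V _ _ H => ⟨H.existsUnique_iso, fun e => ?_⟩, QStack.realizedBy_of_E_eq_a rfl,
    QStack.realizedBy_of_E_eq_b rfl, QStack.realizedBy_of_E_eq_c rfl,
    QStack.realizedBy_of_E_eq_d rfl, QStack.realizedBy_of_E_eq_e rfl,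
    fun a ha ha' => QStack.realizedBy_of_E_eq_f rfl ha ha'⟩
  obtain ⟨a, ha, b, hb, c, hc, h⟩ := QStack.exists_realizedBy_spinTriple (H.reindex e)
  exact ⟨a, ha, b, hb, c, hc, h.of_reindex⟩
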